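/- Let $l_1,l_2,\kappa,\rho,\alpha_1,\beta,\gamma,\mu>0$ and $\alpha:=\alpha_1+\gamma^2\beta$. Let $n\in\mathbb N$, $\mathbf A\in\mathbb R^{n\times n}$, $\mathbf b,\mathbf c\in\mathbb R^n$, $d,\xi_1>0$, and consider the closed-loop system for $z(x,t)$, $x\in(-l_1,0)$, for $(u_1,u_2,w_1,w_2)(x,t)=(v_x,p_x,v_t,p_t)(x,t)$, $x\in(0,l_2)$, and for $q(t)\in\mathbb R^n$: $$z_t=\kappa z_{xx},\qquad u_{1,t}=w_{1,x},\quad u_{2,t}=w_{2,x},\quad \rho w_{1,t}=\alpha u_{1,x}-\gamma\beta u_{2,x},\quad \mu w_{2,t}=\beta u_{2,x}-\gamma\beta u_{1,x},$$ $$z(-l_1,t)=w_2(0,t)=0,\quad z(0,t)=w_1(0,t),\quad \kappa z_x(0,t)=\alpha u_1(0,t)-\gamma\beta u_2(0,t),$$ $$(\alpha u_1-\gamma\beta u_2)(l_2,t)=-\xi_1w_1(l_2,t),\quad (\beta u_2-\gamma\beta u_1)(l_2,t)=-\mathbf c^{\rm T}q(t)-d\,w_2(l_2,t),\quad q_t=\mathbf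 Aq+\mathbf b\,w_2(l_2,t).$$ Assume that all eigenvalues of $\mathbf A$ have negative real part, that $(\mathbf A,\mathbf b)$ is controllable and $(\mathbf A,\mathbf c)$ is observable, and that $0\le\Gamma\le d$ and $d+\mathrm{Re}\,\mathbf c^{\rm T}(isI-\mathbf A)^{-1}\mathbf b>\Gamma$ for all $s\in\mathbb R$. Let $Q,P$ be symmetric positive definite $n\times n$ matrices, $q_1\in\mathbb R^n$ and $\Delta>0$ that satisfy the Meyer–Kalman–Yakubovich equations $$\mathbf A^{\rm T}P+P\mathbf A=-q_1q_1^{\rm T}-\Delta Q,\qquad P\mathbf b-\mathbf c=\sqrt{2(d-\Gamma)}\,q_1 .$$ Let $b_1>0$ and put $$K:=\max\Big(\sqrt{\tfrac{\alpha_1}{\rho}}+\tfrac{\gamma^2\sqrt{\beta\mu}}{\rho},\,2\sqrt{\tfrac{\beta}{\mu}}\Big),\qquad a_1:=2b_1\Big[\tfrac{4l_2\kappa}{l_1^2}+K\Big],$$ $$M:=b_1l_2\Big[\tfrac{8l_2\kappa}{l_1^2}+2K\Big]\max\Big[\sqrt{\tfrac{\rho}{\alpha_1}}+\sqrt{\tfrac{\mu\gamma^2}{\alpha_1}},\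 \sqrt{\tfrac{\mu}{\beta}}+\sqrt{\tfrac{\mu\gamma^2}{\alpha_1}},\ 2,\ \tfrac{\alpha}{\alpha_1}+\tfrac{\gamma^2\beta}{2\alpha_1}\Big].$$ Suppose that, for every nonzero $y\in\mathbb R^n$, $$0<\delta<\frac1{a_1l_2}\min\left(\frac{a_1l_2}{M},\ \frac{2\xi_1}{\rho+\xi_1^2\frac{2}{\alpha_1}},\ \frac{2\Gamma}{\mu+2d^2\frac{\alpha+\gamma^2\beta}{\alpha_1\beta}},\ \frac{\Delta\,y^{\rm T}Qy}{\frac{2\alpha+2\gamma^2\beta}{\alpha_1\beta}\|\mathbf c\|^2\|y\|^2+\frac{8b_1\kappa}{a_1l_1^2}\,y^{\rm T}Py}\right)$$ (for $n=0$ the last term is omitted). Then every mild solution of the closed-loop system, with arbitrary initial state in $L^2(-l_1,0)\times L^2(0,l_2)^4\times\mathbb R^n$, satisfies $$E_{\rm hybrid}(t)\le\frac{1+M\delta}{1-M\delta}\,e^{-\sigma t}\,E_{\rm hybrid}(0)\quad\text{for all }t>0,\qquad \sigma:=\delta(1-M\delta)\frac{8b_1l_2\kappa}{l_1^2},$$ where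 $$E_{\rm hybrid}(t)=\frac12\int_{-l_1}^0|z|^2dx+\frac12\int_0^{l_2}\big[\rho|w_1|^2+\mu|w_2|^2+\alpha_1|u_1|^2+\beta|\gamma u_1-u_2|^2\big]dx+\frac12q^{\rm T}Pq .$$ -/

import Mathlib

open MeasureTheory Matrix

namespace PiezoHeat

/-- Physical data: a heat-conducting rod on `(-l1, 0)` with diffusivity `κ`, joined at `x = 0` to a
magnetizable piezoelectric beam on `(0, l2)`. All constants are positive. -/
structure Plant where
  l1 : ℝ
  l2 : ℝ
  κ : ℝ
  ρ : ℝ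
  α1 : ℝ
  β : ℝ
  γ : ℝ
  μ : ℝ
  l1_pos : 0 < l1
  l2_pos : 0 < l2
  κ_pos : 0 < κ
  ρ_pos : 0 < ρ
  α1_pos : 0 < α1
  β_pos : 0 < β
  γ_pos : 0 < γ
  μ_pos : 0 < μ

/-- The stiffness coefficient `α = α₁ + γ² β`. -/
noncomputable def Plant.α (p : Plant) : ℝ := p.α1 + p.γ ^ 2 * p.β

/-- Data of the hybrid controller `g₁ = -ξ₁ v_t(l₂,t)`, `g₂ = -cᵀ q - d p_t(l₂,t)`,
`q_t = A q + b p_t(l₂,t)`. -/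
structure HybridController (n : ℕ) where
  A : Matrix (Fin n) (Fin n) ℝ
  b : Fin n → ℝ
  c : Fin n → ℝ
  d : ℝ
  ξ1 : ℝ
  d_pos : 0 < d
  ξ1_pos : 0 < ξ1

/-! ### Assumptions on the controller -/

/-- All (complex) eigenvalues of the real matrix `A` have negative real part. -/
def IsHurwitz {n : ℕ} (A : Matrix (Fin n) (Fin n) ℝ) : Prop :=
  ∀ lam : ℂ, Module.End.HasEigenvalue (Matrix.toLin' (A.map (fun a : ℝ => (a : ℂ)))) lam →
    lam.re < 0

/-- `(A, b)` is controllable: `b, A b, …, A^(n-1) b` span `ℝⁿ`. -/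
def IsControllable {n : ℕ} (A : Matrix (Fin n) (Fin n) ℝ) (b : Fin n → ℝ) : Prop :=
  Submodule.span ℝ (Set.range fun k : Fin n => (A ^ (k : ℕ)) *ᵥ b) = ⊤

/-- `(A, c)` (with output `cᵀ q`) is observable: `c, Aᵀ c, …, (Aᵀ)^(n-1) c` span `ℝⁿ`. -/
def IsObservable {n : ℕ} (A : Matrix (Fin n) (Fin n) ℝ) (c : Fin n → ℝ) : Prop :=
  Submodule.span ℝ (Set.range fun k : Fin n => (Aᵀ ^ (k : ℕ)) *ᵥ c) = ⊤

/-- The transfer function `cᵀ (s I - A)⁻¹ b` at a complex number `s`. -/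
noncomputable def HybridController.transfer {n : ℕ} (C : HybridController n) (s : ℂ) : ℂ :=
  (fun i => (C.c i : ℂ)) ⬝ᵥ
    ((s • (1 : Matrix (Fin n) (Fin n) ℂ) - C.A.map (fun a : ℝ => (a : ℂ)))⁻¹ *ᵥ
      fun i => (C.b i : ℂ))

/-- The positive-real condition with parameter `Γ`. -/
def HybridController.PositiveReal {n : ℕ} (C : HybridController n) (Γ : ℝ) : Prop :=
  0 ≤ Γ ∧ Γ ≤ C.d ∧
    ∀ s : ℝ, Γ < C.d + (C.transfer (Complex.I * (s : ℂ))).re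

/-- `P`, `q1`, `Δ` solve the Meyer–Kalman–Yakubovich equations for the positive definite `Q`. -/
def HybridController.MKY {n : ℕ} (C : HybridController n) (Γ : ℝ)
    (Q P : Matrix (Fin n) (Fin n) ℝ) (q1 : Fin n → ℝ) (Δ : ℝ) : Prop :=
  Q.PosDef ∧ P.PosDef ∧ 0 < Δ ∧
    C.Aᵀ * P + P * C.A = -(Matrix.vecMulVec q1 q1) - Δ • Q ∧
    P *ᵥ C.b - C.c = Real.sqrt (2 * (C.d - Γ)) • q1

/-! ### State space and closed-loop dynamics -/

/-- The space `L²(a, b)`. -/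
noncomputable abbrev L2 (a b : ℝ) := Lp ℝ 2 (volume.restrict (Set.Ioc a b))

/-- The state space `L²(-l1, 0) × L²(0, l2)⁴ × ℝⁿ` of `(z, u₁, u₂, w₁, w₂, q)`, where `u₁ = v_x`,
`u₂ = p_x`, `w₁ = v_t`, `w₂ = p_t`. -/
noncomputable abbrev State (p : Plant) (n : ℕ) :=
  L2 (-p.l1) 0 × L2 0 p.l2 × L2 0 p.l2 × L2 0 p.l2 × L2 0 p.l2 × (Fin n → ℝ)

namespace State

variable {p : Plant} {n : ℕ}

noncomputable def z (X : State p n) : L2 (-p.l1) 0 := X.1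
noncomputable def u1 (X : State p n) : L2 0 p.l2 := X.2.1
noncomputable def u2 (X : State p n) : L2 0 p.l2 := X.2.2.1
noncomputable def w1 (X : State p n) : L2 0 p.l2 := X.2.2.2.1
noncomputable def w2 (X : State p n) : L2 0 p.l2 := X.2.2.2.2.1
noncomputable def q (X : State p n) : Fin n → ℝ := X.2.2.2.2.2

end State

/-- `f ∈ H¹(a, b)` with (absolutely) continuous representative `F` and weak derivative
`g ∈ L²(a, b)`. The boundary traces of `f` are `F a` and `F b`. -/
structure IsH1 {a b : ℝ} (f : L2 a b) (F : ℝ → ℝ) (g : L2 a b) : Prop where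
  ae_eq : (f : ℝ → ℝ) =ᵐ[volume.restrict (Set.Ioc a b)] F
  eq_integral : ∀ x ∈ Set.Icc a b, F x = F a + ∫ s in a..x, g s

/-- The closed-loop operator, as a relation: `X` lies in its domain and `Y` is its value at `X`.
The functions `z`, `zx`, `u1`, `u2`, `w1`, `w2` are the continuous representatives. -/
def ClosedLoop (p : Plant) {n : ℕ} (C : HybridController n) (X Y : State p n) : Prop :=
  ∃ (z zx u1 u2 w1 w2 : ℝ → ℝ) (Dz DDz : L2 (-p.l1) 0) (Du1 Du2 Dw1 Dw2 : L2 0 p.l2),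
    -- regularity: `z ∈ H²(-l1, 0)` and `u₁, u₂, w₁, w₂ ∈ H¹(0, l2)`
    IsH1 X.z z Dz ∧ IsH1 Dz zx DDz ∧
    IsH1 X.u1 u1 Du1 ∧ IsH1 X.u2 u2 Du2 ∧ IsH1 X.w1 w1 Dw1 ∧ IsH1 X.w2 w2 Dw2 ∧
    -- conditions at the left end and at the joint
    z (-p.l1) = 0 ∧ w2 0 = 0 ∧ z 0 = w1 0 ∧
    p.κ * zx 0 = p.α * u1 0 - p.γ * p.β * u2 0 ∧
    -- feedback at the right end
    p.α * u1 p.l2 - p.γ * p.β * u2 p.l2 = -C.ξ1 * w1 p.l2 ∧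
    -p.γ * p.β * u1 p.l2 + p.β * u2 p.l2 = -(C.c ⬝ᵥ X.q) - C.d * w2 p.l2 ∧
    -- dynamics
    Y.z = p.κ • DDz ∧
    Y.u1 = Dw1 ∧
    Y.u2 = Dw2 ∧
    p.ρ • Y.w1 = p.α • Du1 - (p.γ * p.β) • Du2 ∧
    p.μ • Y.w2 = -(p.γ * p.β) • Du1 + p.β • Du2 ∧
    Y.q = C.A *ᵥ X.q + w2 p.l2 • C.b

/-- Mild (finite-energy) solutions of the closed-loop system on `[0, ∞)`: `X` is continuous in the
state space, `∫₀ᵗ X` lies in the domain of the closed-loop operator, and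
`X t - X 0` is the value of the operator at `∫₀ᵗ X`. Classical solutions are mild solutions, and
the initial state `X 0` is any element of the state space. -/
def IsSolution (p : Plant) {n : ℕ} (C : HybridController n) (X : ℝ → State p n) : Prop :=
  ContinuousOn X (Set.Ici 0) ∧
    ∀ t : ℝ, 0 ≤ t → ClosedLoop p C (∫ s in (0 : ℝ)..t, X s) (X t - X 0)

/-! ### Energies and constants -/

/-- The energy of the rod and the beam. -/
noncomputable def energy {p : Plant} {n : ℕ} (X : State p n) : ℝ :=
  1 / 2 * (∫ x in (-p.l1)..0, (X.z x) ^ 2) +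
  1 / 2 * ∫ x in (0 : ℝ)..p.l2,
    (p.ρ * (X.w1 x) ^ 2 + p.μ * (X.w2 x) ^ 2 + p.α1 * (X.u1 x) ^ 2
      + p.β * (p.γ * X.u1 x - X.u2 x) ^ 2)

/-- The augmented energy `E + ½ qᵀ P q`. -/
noncomputable def energyHybrid {p : Plant} {n : ℕ} (P : Matrix (Fin n) (Fin n) ℝ)
    (X : State p n) : ℝ :=
  energy X + 1 / 2 * (X.q ⬝ᵥ (P *ᵥ X.q))

/-- `max (√(α₁/ρ) + γ² √(βμ)/ρ, 2 √(β/μ))`. -/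
noncomputable def Plant.speed (p : Plant) : ℝ :=
  max (Real.sqrt (p.α1 / p.ρ) + p.γ ^ 2 * Real.sqrt (p.β * p.μ) / p.ρ)
    (2 * Real.sqrt (p.β / p.μ))

/-- The constant `a₁` attached to `b₁`. -/
noncomputable def Plant.a1 (p : Plant) (b1 : ℝ) : ℝ :=
  2 * b1 * (4 * p.l2 * p.κ / p.l1 ^ 2 + p.speed)

/-- The constant `M̃`. -/
noncomputable def Plant.Mtilde (p : Plant) : ℝ :=
  (8 * p.l2 * p.κ / p.l1 ^ 2 + 2 * p.speed) *
    max (Real.sqrt (p.ρ / p.α1) + Real.sqrt (p.μ * p.γ ^ 2 / p.α1))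
      (max (Real.sqrt (p.μ / p.β) + Real.sqrt (p.μ * p.γ ^ 2 / p.α1))
        (max 2 (p.α / p.α1 + p.γ ^ 2 * p.β / (2 * p.α1))))

/-- The constant `M = b₁ l₂ M̃`. -/
noncomputable def Plant.M (p : Plant) (b1 : ℝ) : ℝ := b1 * p.l2 * p.Mtilde

/-- The smallness condition on `δ`: it is positive and below the explicit bound. The last term of
the bound is to be taken at every nonzero `q ∈ ℝⁿ`; `q ⬝ᵥ q` is the squared Euclidean norm. -/
def DeltaAdmissible (p : Plant) {n : ℕ} (C : HybridController n) (Γ : ℝ)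
    (Q P : Matrix (Fin n) (Fin n) ℝ) (Δ b1 δ : ℝ) : Prop :=
  0 < δ ∧
  δ < 1 / (p.a1 b1 * p.l2) *
    min (p.a1 b1 * p.l2 / p.M b1)
      (min (2 * C.ξ1 / (p.ρ + C.ξ1 ^ 2 * (2 / p.α1)))
        (2 * Γ / (p.μ + 2 * C.d ^ 2 * ((p.α + p.γ ^ 2 * p.β) / (p.α1 * p.β))))) ∧
  ∀ q : Fin n → ℝ, q ≠ 0 →
    δ < 1 / (p.a1 b1 * p.l2) *
      (Δ * (q ⬝ᵥ (Q *ᵥ q)) /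
        ((2 * p.α + 2 * p.γ ^ 2 * p.β) / (p.α1 * p.β) * (C.c ⬝ᵥ C.c) * (q ⬝ᵥ q)
          + 8 * b1 * p.κ / (p.a1 b1 * p.l1 ^ 2) * (q ⬝ᵥ (P *ᵥ q))))

/-- The decay rate `σ = δ (1 - M δ) 8 b₁ l₂ κ / l₁²`. -/
noncomputable def Plant.decayRate (p : Plant) (b1 δ : ℝ) : ℝ :=
  δ * (1 - p.M b1 * δ) * (8 * b1 * p.l2 * p.κ / p.l1 ^ 2)

end PiezoHeat

/-! The proof is a Lyapunov argument with `V = E + δ a₁ F`, where `E` is the hybrid energy and `F =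
∫ x (ρ w₁ u₁ + μ w₂ u₂)` a multiplier on the beam.

Along the closed loop (`ClosedLoop.identities`) the joint terms in `E'` cancel, leaving `-κ‖z_x‖²`,
damping by `ξ₁`, and controller terms; completing a square in the MKY equations bounds the latter by
`-Γ w₂(l₂)² - ½ Δ qᵀQq` (`HybridController.MKY.dissipation`). The weight `x` vanishes at the joint,
so `F'` is minus half the beam form plus a boundary term at `l₂`. The feedback laws express the
strains there through `w₁(l₂)`, `w₂(l₂)` and `cᵀq` (`elastic_le`). The bounds on `δ` let the
dissipation in `E'` absorb that boundary term, and Poincaré's inequality turns `‖z_x‖²` into heat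
energy. Hence `V' ≤ -r E` with `r = 8 δ b₁ l₂ κ / l₁²` (`ClosedLoop.dissipation`).

Since `|V - E| ≤ M δ E` with `M δ < 1` (`abs_lyapunov_sub_le`), `V' ≤ -(1 - M δ) r V`. Decay of `V`
gives decay of `E` with the factor `(1 + Mδ)/(1 - Mδ)`.

A mild solution cannot be differentiated directly. Its averages over `[t, t + h]` are differentiable
and stay in the domain by linearity; the estimate for them passes to the limit `h → 0⁺` because `E`
is continuous. -/

namespace PiezoHeat

/-! ### Weighted pairings on `L²(a, b)` -/

section Pairing

variable {a b : ℝ}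

theorem exists_bound_on_Ioc (m : C(ℝ, ℝ)) (a b : ℝ) :
    ∃ B : ℝ, 0 ≤ B ∧ ∀ x ∈ Set.Ioc a b, |m x| ≤ B := by
  obtain ⟨B, hB⟩ := (isCompact_Icc (a := a) (b := b)).exists_bound_of_continuousOn
    m.continuous.continuousOn
  exact ⟨max B 0, le_max_right _ _, fun x hx =>
    (hB x (Set.Ioc_subset_Icc_self hx)).trans (le_max_left _ _)⟩

theorem L2.integrable_mul (f g : L2 a b) :
    Integrable (fun x => f x * g x) (volume.restrict (Set.Ioc a b)) :=
  (Lp.memLp f).integrable_mul (Lp.memLp g)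

theorem L2.integrable_weight_mul (m : C(ℝ, ℝ)) (f g : L2 a b) :
    Integrable (fun x => m x * (f x * g x)) (volume.restrict (Set.Ioc a b)) := by
  obtain ⟨B, -, hB⟩ := exists_bound_on_Ioc m a b
  refine (L2.integrable_mul f g).bdd_mul (c := B) m.continuous.aestronglyMeasurable ?_
  filter_upwards [ae_restrict_mem measurableSet_Ioc] with x hx using hB x hx

theorem L2.integral_abs_mul_le (f g : L2 a b) :
    ∫ x in Set.Ioc a b, |f x * g x| ≤ ‖f‖ * ‖g‖ := by
  have h := real_inner_le_norm |f| |g|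
  rw [norm_abs_eq_norm, norm_abs_eq_norm, L2.inner_def] at h
  refine le_trans (le_of_eq (integral_congr_ae ?_)) h
  filter_upwards [Lp.coeFn_abs f, Lp.coeFn_abs g] with x hf hg
  simp [hf, hg, abs_mul, mul_comm]

theorem L2.abs_integral_weight_mul_le (m : C(ℝ, ℝ)) {B : ℝ}
    (hB : ∀ x ∈ Set.Ioc a b, |m x| ≤ B) (hB0 : 0 ≤ B) (f g : L2 a b) :
    ‖∫ x in Set.Ioc a b, m x * (f x * g x)‖ ≤ B * ‖f‖ * ‖g‖ := by
  calc ‖∫ x in Set.Ioc a b, m x * (f x * g x)‖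
      ≤ ∫ x in Set.Ioc a b, B * |f x * g x| := by
        refine norm_integral_le_of_norm_le ((L2.integrable_mul f g).abs.const_mul B) ?_
        filter_upwards [ae_restrict_mem measurableSet_Ioc] with x hx
        rw [Real.norm_eq_abs, abs_mul]
        exact mul_le_mul_of_nonneg_right (hB x hx) (abs_nonneg _)
    _ ≤ B * ‖f‖ * ‖g‖ := by
        rw [integral_const_mul, mul_assoc]
        exact mul_le_mul_of_nonneg_left (L2.integral_abs_mul_le f g) hB0

/-- The weighted pairing `(f, g) ↦ ∫ m f g` on `L²(a, b)`. -/
noncomputable def pair (m : C(ℝ, ℝ)) : L2 a b →L[ℝ] L2 a b →L[ℝ] ℝ :=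
  LinearMap.mkContinuousOfExistsBound₂
    (LinearMap.mk₂ ℝ (fun f g : L2 a b => ∫ x in Set.Ioc a b, m x * (f x * g x))
      (fun f f' g => by
        rw [← integral_add (L2.integrable_weight_mul m f g) (L2.integrable_weight_mul m f' g)]
        refine integral_congr_ae ?_
        filter_upwards [Lp.coeFn_add f f'] with x h
        simp only [h, Pi.add_apply]; ring)
      (fun c f g => by
        rw [smul_eq_mul, ← integral_const_mul]
        refine integral_congr_ae ?_
        filter_upwards [Lp.coeFn_smul c f] with x h
        simp only [h, Pi.smul_apply, smul_eq_mul]; ring)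
      (fun f g g' => by
        rw [← integral_add (L2.integrable_weight_mul m f g) (L2.integrable_weight_mul m f g')]
        refine integral_congr_ae ?_
        filter_upwards [Lp.coeFn_add g g'] with x h
        simp only [h, Pi.add_apply]; ring)
      (fun c f g => by
        rw [smul_eq_mul, ← integral_const_mul]
        refine integral_congr_ae ?_
        filter_upwards [Lp.coeFn_smul c g] with x h
        simp only [h, Pi.smul_apply, smul_eq_mul]; ring))
    (by
      obtain ⟨B, hB0, hB⟩ := exists_bound_on_Ioc m a b
      exact ⟨B, fun f g => L2.abs_integral_weight_mul_le m hB hB0 f g⟩)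

theorem pair_apply (m : C(ℝ, ℝ)) (f g : L2 a b) :
    pair m f g = ∫ x in Set.Ioc a b, m x * (f x * g x) := rfl

theorem pair_comm (m : C(ℝ, ℝ)) (f g : L2 a b) : pair m f g = pair m g f := by
  simp only [pair_apply, mul_comm]

theorem pair_one_self_nonneg (f : L2 a b) : 0 ≤ pair 1 f f := by
  rw [pair_apply]
  exact integral_nonneg fun x => by simpa using mul_self_nonneg (f x)

theorem _root_.HasDerivAt.pair (m : C(ℝ, ℝ)) {f g : ℝ → L2 a b} {f' g' : L2 a b} {t : ℝ}
    (hf : HasDerivAt f f' t) (hg : HasDerivAt g g' t) :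
    HasDerivAt (fun s => pair m (f s) (g s)) (pair m f' (g t) + pair m (f t) g') t := by
  have := (PiezoHeat.pair m).hasDerivAt_of_bilinear (fun _ => hf) (fun _ => hg)
  rwa [add_comm] at this

end Pairing

/-! ### Integration by parts -/

section H1

variable {a b : ℝ}

theorem L2.intervalIntegrable (hab : a ≤ b) (f : L2 a b) : IntervalIntegrable f volume a b := by
  rw [intervalIntegrable_iff_integrableOn_Ioc_of_le hab]
  exact (Lp.memLp f).integrable (by norm_num)

theorem integral_eq_sub_of_ae_hasDerivAt {h h' : ℝ → ℝ}
    (hac : AbsolutelyContinuousOnInterval h a b)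
    (hd : ∀ᵐ x, x ∈ Set.uIcc a b → HasDerivAt h (h' x) x) :
    ∫ x in a..b, h' x = h b - h a := by
  rw [← hac.integral_deriv_eq_sub]
  refine intervalIntegral.integral_congr_ae ?_
  filter_upwards [hd] with x hx hxm
  exact (hx (Set.uIoc_subset_uIcc hxm)).deriv.symm

theorem L2.absolutelyContinuous_primitive (hab : a ≤ b) (f : L2 a b) (c : ℝ) :
    AbsolutelyContinuousOnInterval (fun x => c + ∫ s in a..x, f s) a b :=
  (LipschitzWith.const c).lipschitzOnWith.absolutelyContinuousOnInterval.add
    ((L2.intervalIntegrable hab f).absolutelyContinuousOnInterval_intervalIntegral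
      Set.left_mem_uIcc)

theorem L2.ae_hasDerivAt_primitive (hab : a ≤ b) (f : L2 a b) (c : ℝ) :
    ∀ᵐ x, x ∈ Set.uIcc a b → HasDerivAt (fun x => c + ∫ s in a..x, f s) (f x) x := by
  filter_upwards [(L2.intervalIntegrable hab f).ae_hasDerivAt_integral] with x hx hxm
  exact (hx hxm a Set.left_mem_uIcc).const_add _

variable {f g Df Dg : L2 a b} {F G : ℝ → ℝ}

/-- Integration by parts with a `C¹` weight. -/
theorem IsH1.pair_add_pair (hab : a ≤ b) (hf : IsH1 f F Df) (hg : IsH1 g G Dg) (m m' : C(ℝ, ℝ))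
    (hm : ContDiff ℝ 1 m) (hm' : ∀ x, HasDerivAt m (m' x) x) :
    pair m f Dg + pair m Df g + pair m' f g = m b * (F b * G b) - m a * (F a * G a) := by
  -- `F` is controlled only on `[a, b]`; the primitive is defined on all of `ℝ`, so it has two-sided
  -- derivatives almost everywhere.
  set F' : ℝ → ℝ := fun x => F a + ∫ s in a..x, Df s with hF'
  set G' : ℝ → ℝ := fun x => G a + ∫ s in a..x, Dg s with hG'
  have hFe : ∀ x ∈ Set.Icc a b, F x = F' x := hf.eq_integral
  have hGe : ∀ x ∈ Set.Icc a b, G x = G' x := hg.eq_integral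
  have hac : AbsolutelyContinuousOnInterval (fun x => m x * (F' x * G' x)) a b :=
    hm.contDiffOn.absolutelyContinuousOnInterval.mul
      ((L2.absolutelyContinuous_primitive hab Df (F a)).mul
        (L2.absolutelyContinuous_primitive hab Dg (G a)))
  have key := integral_eq_sub_of_ae_hasDerivAt hac
    (h' := fun x => m' x * (F' x * G' x) + m x * (Df x * G' x + F' x * Dg x)) (by
      filter_upwards [L2.ae_hasDerivAt_primitive hab Df (F a),
        L2.ae_hasDerivAt_primitive hab Dg (G a)] with x h1 h2 hx
      exact (hm' x).mul ((h1 hx).mul (h2 hx)))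
  rw [hFe b (Set.right_mem_Icc.2 hab), hGe b (Set.right_mem_Icc.2 hab),
    hFe a (Set.left_mem_Icc.2 hab), hGe a (Set.left_mem_Icc.2 hab), ← key,
    intervalIntegral.integral_of_le hab, pair_apply, pair_apply, pair_apply,
    ← integral_add (L2.integrable_weight_mul _ _ _) (L2.integrable_weight_mul _ _ _),
    ← integral_add (by exact (L2.integrable_weight_mul _ _ _).add (L2.integrable_weight_mul _ _ _))
      (L2.integrable_weight_mul _ _ _)]
  refine integral_congr_ae ?_
  filter_upwards [hf.ae_eq, hg.ae_eq, ae_restrict_mem measurableSet_Ioc] with x h1 h2 hx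
  rw [h1, h2, hFe x (Set.Ioc_subset_Icc_self hx), hGe x (Set.Ioc_subset_Icc_self hx)]
  ring

theorem IsH1.pair_one (hab : a ≤ b) (hf : IsH1 f F Df) (hg : IsH1 g G Dg) :
    pair 1 f Dg + pair 1 Df g = F b * G b - F a * G a := by
  have h := hf.pair_add_pair hab hg 1 0 contDiff_const (fun x => hasDerivAt_const x 1)
  simpa [pair_apply] using h

theorem IsH1.pair_id (hab : a ≤ b) (hf : IsH1 f F Df) (hg : IsH1 g G Dg) :
    pair (.id ℝ) f Dg + pair (.id ℝ) Df g + pair 1 f g = b * (F b * G b) - a * (F a * G a) :=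
  hf.pair_add_pair hab hg (.id ℝ) 1 contDiff_id (fun x => hasDerivAt_id x)

/-- Nonnegativity of the variance: expand `∫ (h - c)²` with `c` the mean of `h`. -/
theorem sq_integral_le {h : ℝ → ℝ} (hab : a ≤ b) (hi : IntervalIntegrable h volume a b)
    (hi2 : IntervalIntegrable (fun x => h x ^ 2) volume a b) :
    (∫ x in a..b, h x) ^ 2 ≤ (b - a) * ∫ x in a..b, h x ^ 2 := by
  rcases hab.eq_or_lt with rfl | hlt
  · simp
  have hpos : 0 < b - a := sub_pos.2 hlt
  set I := ∫ x in a..b, h x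
  set c := I / (b - a)
  have h0 : 0 ≤ ∫ x in a..b, (h x - c) ^ 2 :=
    intervalIntegral.integral_nonneg hab fun x _ => sq_nonneg _
  have h1 : ∫ x in a..b, (h x - c) ^ 2 = (∫ x in a..b, h x ^ 2) - 2 * c * I + c ^ 2 * (b - a) := by
    have : ∀ x, (h x - c) ^ 2 = h x ^ 2 - 2 * c * h x + c ^ 2 := fun x => by ring
    simp only [this]
    rw [intervalIntegral.integral_add (hi2.sub (hi.const_mul _)) (by simp),
      intervalIntegral.integral_sub hi2 (hi.const_mul _), intervalIntegral.integral_const_mul,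
      intervalIntegral.integral_const, smul_eq_mul]
    ring
  have hc : c * (b - a) = I := div_mul_cancel₀ _ hpos.ne'
  nlinarith [mul_nonneg hpos.le (h1 ▸ h0)]

/-- Poincaré's inequality for functions that vanish at the left end point. -/
theorem IsH1.poincare (hab : a ≤ b) (hf : IsH1 f F Df) (h0 : F a = 0) :
    pair 1 f f ≤ (b - a) ^ 2 / 2 * pair 1 Df Df := by
  have hi := L2.intervalIntegrable hab Df
  have hi2 : IntervalIntegrable (fun x => Df x ^ 2) volume a b := by
    rw [intervalIntegrable_iff_integrableOn_Ioc_of_le hab]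
    simpa only [sq, IntegrableOn] using L2.integrable_mul Df Df
  have hD : pair 1 Df Df = ∫ x in a..b, Df x ^ 2 := by
    rw [intervalIntegral.integral_of_le hab, pair_apply]
    simp [sq]
  -- Cauchy–Schwarz on `[a, x]`; integrating the weight `x - a` then gives the constant `(b - a)² /
  -- 2`.
  have hpt : ∀ x ∈ Set.Icc a b, F x ^ 2 ≤ (x - a) * pair 1 Df Df := by
    intro x hx
    have hsub : Set.uIcc a x ⊆ Set.uIcc a b := by
      rw [Set.uIcc_of_le hx.1, Set.uIcc_of_le hab]; exact Set.Icc_subset_Icc_right hx.2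
    rw [hf.eq_integral x hx, h0, zero_add, hD]
    refine (sq_integral_le hx.1 (hi.mono_set hsub) (hi2.mono_set hsub)).trans
      (mul_le_mul_of_nonneg_left ?_ (sub_nonneg.2 hx.1))
    exact intervalIntegral.integral_mono_interval le_rfl hx.1 hx.2
      (Filter.Eventually.of_forall fun x => sq_nonneg _) hi2
  have hf2 : pair 1 f f = ∫ x in a..b, f x ^ 2 := by
    rw [intervalIntegral.integral_of_le hab, pair_apply]
    simp [sq]
  have hint : ∫ x in a..b, (x - a) * pair 1 Df Df = (b - a) ^ 2 / 2 * pair 1 Df Df := by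
    rw [intervalIntegral.integral_mul_const, intervalIntegral.integral_sub (by simp) (by simp),
      integral_id, intervalIntegral.integral_const, smul_eq_mul]
    ring
  rw [hf2, ← hint, intervalIntegral.integral_of_le hab, intervalIntegral.integral_of_le hab]
  refine integral_mono_ae ?_ ?_ ?_
  · simpa only [sq] using L2.integrable_mul f f
  · have : Continuous fun x : ℝ => (x - a) * pair 1 Df Df := by fun_prop
    exact (this.integrableOn_Icc).mono_set Set.Ioc_subset_Icc_self
  · filter_upwards [hf.ae_eq, ae_restrict_mem measurableSet_Ioc] with x h1 hx
    rw [h1]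
    exact hpt x (Set.Ioc_subset_Icc_self hx)

theorem IsH1.smul_sub (hab : a ≤ b) (hf : IsH1 f F Df) (hg : IsH1 g G Dg) (c : ℝ) :
    IsH1 (c • (f - g)) (fun x => c * (F x - G x)) (c • (Df - Dg)) where
  ae_eq := by
    filter_upwards [hf.ae_eq, hg.ae_eq, Lp.coeFn_smul c (f - g), Lp.coeFn_sub f g]
      with x h1 h2 h3 h4
    rw [h3, Pi.smul_apply, h4, Pi.sub_apply, h1, h2, smul_eq_mul]
  eq_integral := by
    intro x hx
    have hsub : Set.uIcc a x ⊆ Set.uIcc a b := by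
      rw [Set.uIcc_of_le hx.1, Set.uIcc_of_le hab]; exact Set.Icc_subset_Icc_right hx.2
    have h : ∫ s in a..x, (c • (Df - Dg) : L2 a b) s = ∫ s in a..x, c * (Df s - Dg s) := by
      rw [intervalIntegral.integral_of_le hx.1, intervalIntegral.integral_of_le hx.1]
      refine integral_congr_ae (ae_restrict_of_ae_restrict_of_subset
        (Set.Ioc_subset_Ioc_right hx.2) ?_)
      filter_upwards [Lp.coeFn_smul c (Df - Dg), Lp.coeFn_sub Df Dg] with y h3 h4
      rw [h3, Pi.smul_apply, h4, Pi.sub_apply, smul_eq_mul]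
    rw [h, intervalIntegral.integral_const_mul, intervalIntegral.integral_sub
      ((L2.intervalIntegrable hab Df).mono_set hsub) ((L2.intervalIntegrable hab Dg).mono_set hsub),
      hf.eq_integral x hx, hg.eq_integral x hx]
    ring

end H1

variable {p : Plant} {n : ℕ}

/-! ### The Lyapunov functional -/

/-- The quadratic form `α u₁² - 2 γ β u₁ u₂ + β u₂² + ρ w₁² + μ w₂²` on `L²(0, l₂)⁴`. -/
noncomputable def beamForm (X : State p n) : ℝ :=
  p.ρ * pair 1 X.w1 X.w1 + p.μ * pair 1 X.w2 X.w2 + p.α * pair 1 X.u1 X.u1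
    - 2 * (p.γ * p.β) * pair 1 X.u1 X.u2 + p.β * pair 1 X.u2 X.u2

/-- Completing the square with `α = α₁ + γ²β`. The expanded form suits differentiation, the sum of
squares shows positivity. -/
theorem beamForm_eq_integral (X : State p n) :
    beamForm X = ∫ x in (0 : ℝ)..p.l2,
      (p.ρ * (X.w1 x) ^ 2 + p.μ * (X.w2 x) ^ 2 + p.α1 * (X.u1 x) ^ 2
        + p.β * (p.γ * X.u1 x - X.u2 x) ^ 2) := by
  have h := fun f g : L2 0 p.l2 => L2.integrable_mul f g
  simp only [beamForm, intervalIntegral.integral_of_le p.l2_pos.le, pair_apply,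
    ContinuousMap.one_apply, one_mul]
  rw [← integral_const_mul, ← integral_const_mul, ← integral_const_mul, ← integral_const_mul,
    ← integral_const_mul, ← integral_add, ← integral_add, ← integral_sub, ← integral_add]
  · refine integral_congr_ae (Filter.Eventually.of_forall fun x => ?_)
    simp only [Plant.α]; ring
  all_goals
    first
    | exact (h _ _).const_mul _
    | exact ((h _ _).const_mul _).add ((h _ _).const_mul _)
    | exact (((h _ _).const_mul _).add ((h _ _).const_mul _)).add ((h _ _).const_mul _)
    | exact ((((h _ _).const_mul _).add ((h _ _).const_mul _)).add ((h _ _).const_mul _)).sub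
        ((h _ _).const_mul _)

theorem beamForm_nonneg (X : State p n) : 0 ≤ beamForm X := by
  rw [beamForm_eq_integral]
  refine intervalIntegral.integral_nonneg p.l2_pos.le fun x _ => ?_
  have := p.ρ_pos; have := p.α1_pos; have := p.β_pos; have := p.μ_pos
  positivity

theorem energy_eq (X : State p n) :
    energy X = 1 / 2 * pair 1 X.z X.z + 1 / 2 * beamForm X := by
  have hl1 : -p.l1 ≤ 0 := by linarith [p.l1_pos]
  rw [energy, ← beamForm_eq_integral, intervalIntegral.integral_of_le hl1, pair_apply]
  simp only [ContinuousMap.one_apply, one_mul, ← sq]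

theorem energyHybrid_eq (P : Matrix (Fin n) (Fin n) ℝ) (X : State p n) :
    energyHybrid P X = 1 / 2 * pair 1 X.z X.z + 1 / 2 * beamForm X
      + 1 / 2 * (X.q ⬝ᵥ (P *ᵥ X.q)) := by
  rw [energyHybrid, energy_eq]

/-- The multiplier functional `∫ x (ρ w₁ u₁ + μ w₂ u₂)`. -/
noncomputable def multiplier (X : State p n) : ℝ :=
  p.ρ * pair (.id ℝ) X.w1 X.u1 + p.μ * pair (.id ℝ) X.w2 X.u2

/-- The derivative of the hybrid energy at `X` in the direction `Y`, for symmetric `P`. -/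
noncomputable def energyRate (P : Matrix (Fin n) (Fin n) ℝ) (X Y : State p n) : ℝ :=
  pair 1 Y.z X.z + (p.ρ * pair 1 Y.w1 X.w1 + p.μ * pair 1 Y.w2 X.w2 + p.α * pair 1 Y.u1 X.u1
    - (p.γ * p.β) * (pair 1 Y.u1 X.u2 + pair 1 X.u1 Y.u2) + p.β * pair 1 Y.u2 X.u2)
  + Y.q ⬝ᵥ (P *ᵥ X.q)

/-- The derivative of `multiplier` at `X` in the direction `Y`. -/
noncomputable def multiplierRate (X Y : State p n) : ℝ :=
  p.ρ * (pair (.id ℝ) Y.w1 X.u1 + pair (.id ℝ) X.w1 Y.u1)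
    + p.μ * (pair (.id ℝ) Y.w2 X.u2 + pair (.id ℝ) X.w2 Y.u2)

section Deriv

variable {Z : ℝ → State p n} {Z' : State p n} {t : ℝ}

theorem hasDerivAt_multiplier (hZ : HasDerivAt Z Z' t) :
    HasDerivAt (fun s => multiplier (Z s)) (multiplierRate (Z t) Z') t := by
  have hu1 : HasDerivAt (fun s => (Z s).u1) Z'.u1 t := hZ.snd.fst
  have hu2 : HasDerivAt (fun s => (Z s).u2) Z'.u2 t := hZ.snd.snd.fst
  have hw1 : HasDerivAt (fun s => (Z s).w1) Z'.w1 t := hZ.snd.snd.snd.fst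
  have hw2 : HasDerivAt (fun s => (Z s).w2) Z'.w2 t := hZ.snd.snd.snd.snd.fst
  exact ((hw1.pair _ hu1).const_mul _).add ((hw2.pair _ hu2).const_mul _)

theorem hasDerivAt_energyHybrid {P : Matrix (Fin n) (Fin n) ℝ} (hP : Pᵀ = P)
    (hZ : HasDerivAt Z Z' t) :
    HasDerivAt (fun s => energyHybrid P (Z s)) (energyRate P (Z t) Z') t := by
  have hz : HasDerivAt (fun s => (Z s).z) Z'.z t := hZ.fst
  have hu1 : HasDerivAt (fun s => (Z s).u1) Z'.u1 t := hZ.snd.fst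
  have hu2 : HasDerivAt (fun s => (Z s).u2) Z'.u2 t := hZ.snd.snd.fst
  have hw1 : HasDerivAt (fun s => (Z s).w1) Z'.w1 t := hZ.snd.snd.snd.fst
  have hw2 : HasDerivAt (fun s => (Z s).w2) Z'.w2 t := hZ.snd.snd.snd.snd.fst
  have hq : HasDerivAt (fun s => (Z s).q) Z'.q t := hZ.snd.snd.snd.snd.snd
  have hqP : HasDerivAt (fun s => (Z s).q ⬝ᵥ (P *ᵥ (Z s).q))
      (Z'.q ⬝ᵥ (P *ᵥ (Z t).q) + (Z t).q ⬝ᵥ (P *ᵥ Z'.q)) t := by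
    have hc : ∀ i, HasDerivAt (fun s => (Z s).q i) (Z'.q i) t := hasDerivAt_pi.1 hq
    have hPc : ∀ i, HasDerivAt (fun s => (P *ᵥ (Z s).q) i) ((P *ᵥ Z'.q) i) t := fun i => by
      simp only [mulVec, dotProduct]
      exact HasDerivAt.fun_sum fun j _ => (hc j).const_mul _
    simp only [dotProduct, ← Finset.sum_add_distrib]
    exact HasDerivAt.fun_sum fun i _ => (hc i).mul (hPc i)
  have hsymm : (Z t).q ⬝ᵥ (P *ᵥ Z'.q) = Z'.q ⬝ᵥ (P *ᵥ (Z t).q) := by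
    rw [dotProduct_mulVec, ← mulVec_transpose, hP, dotProduct_comm]
  simp only [energyHybrid_eq, beamForm]
  refine ((((hz.pair 1 hz).const_mul (1 / 2)).add
    ((((((hw1.pair 1 hw1).const_mul p.ρ).add ((hw2.pair 1 hw2).const_mul p.μ)).add
      ((hu1.pair 1 hu1).const_mul p.α)).sub ((hu1.pair 1 hu2).const_mul (2 * (p.γ * p.β)))).add
      ((hu2.pair 1 hu2).const_mul p.β) |>.const_mul (1 / 2))).add
    (hqP.const_mul (1 / 2))).congr_deriv ?_
  rw [hsymm, energyRate, pair_comm 1 (Z t).z, pair_comm 1 (Z t).w1 Z'.w1,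
    pair_comm 1 (Z t).w2 Z'.w2, pair_comm 1 (Z t).u1 Z'.u1, pair_comm 1 (Z t).u2 Z'.u2]
  ring

end Deriv

theorem continuous_energyHybrid (P : Matrix (Fin n) (Fin n) ℝ) :
    Continuous (energyHybrid P : State p n → ℝ) := by
  have hz : Continuous (State.z : State p n → _) := continuous_fst
  have hu1 : Continuous (State.u1 : State p n → _) := continuous_snd.fst
  have hu2 : Continuous (State.u2 : State p n → _) := continuous_snd.snd.fst
  have hw1 : Continuous (State.w1 : State p n → _) := continuous_snd.snd.snd.fst
  have hw2 : Continuous (State.w2 : State p n → _) := continuous_snd.snd.snd.snd.fst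
  have hq : Continuous (State.q : State p n → _) := continuous_snd.snd.snd.snd.snd
  have hqP : Continuous fun X : State p n => X.q ⬝ᵥ (P *ᵥ X.q) :=
    hq.dotProduct (continuous_const.matrix_mulVec hq)
  have hpair : ∀ {a b : ℝ} {f g : State p n → L2 a b}, Continuous f → Continuous g →
      Continuous fun X => pair 1 (f X) (g X) := fun hf hg =>
    ((pair 1).continuous.comp hf).clm_apply hg
  simp only [funext (energyHybrid_eq P), beamForm]
  have h1 := hpair hz hz
  have h2 := hpair hw1 hw1
  have h3 := hpair hw2 hw2
  have h4 := hpair hu1 hu1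
  have h5 := hpair hu1 hu2
  have h6 := hpair hu2 hu2
  fun_prop

/-! ### Comparison of the multiplier with the energy -/

/-- The constant that bounds `ρ w₁ u₁ + μ w₂ u₂` by the energy density. -/
noncomputable def Plant.densityBound (p : Plant) : ℝ :=
  max (Real.sqrt (p.ρ / p.α1) + Real.sqrt (p.μ * p.γ ^ 2 / p.α1))
    (max (Real.sqrt (p.μ / p.β) + Real.sqrt (p.μ * p.γ ^ 2 / p.α1))
      (max 2 (p.α / p.α1 + p.γ ^ 2 * p.β / (2 * p.α1))))

/-- Weighted AM–GM: with `s = √(a/c)`, so `a = s²c`, this is `s c (s|x| - |y|)² ≥ 0`. -/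
theorem abs_two_mul_le_sqrt_div {a c : ℝ} (ha : 0 < a) (hc : 0 < c) (x y : ℝ) :
    2 * (a * |x * y|) ≤ Real.sqrt (a / c) * (a * x ^ 2 + c * y ^ 2) := by
  set s := Real.sqrt (a / c) with hs
  have hs0 : 0 < s := Real.sqrt_pos.2 (div_pos ha hc)
  have hs2 : s ^ 2 * c = a := by
    rw [hs, Real.sq_sqrt (div_pos ha hc).le, div_mul_cancel₀ _ hc.ne']
  have h : 0 ≤ s * c * (s * |x| - |y|) ^ 2 := by positivity
  rw [abs_mul, ← sq_abs x, ← sq_abs y]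
  have : a = s ^ 2 * c := hs2.symm
  rw [this]
  nlinarith

theorem Plant.density_le (p : Plant) (u1 u2 w1 w2 : ℝ) :
    |p.ρ * (w1 * u1) + p.μ * (w2 * u2)| ≤ p.densityBound * (1 / 2 *
      (p.ρ * w1 ^ 2 + p.μ * w2 ^ 2 + p.α1 * u1 ^ 2 + p.β * (p.γ * u1 - u2) ^ 2)) := by
  have hρ := p.ρ_pos
  have hα := p.α1_pos
  have hβ := p.β_pos
  have hγ := p.γ_pos
  have hμ := p.μ_pos
  have h1 := abs_two_mul_le_sqrt_div hρ hα w1 u1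
  have h2 := abs_two_mul_le_sqrt_div hμ hβ w2 (p.γ * u1 - u2)
  -- The energy density contains `γ u₁ - u₂` rather than `u₂`, so `u₂` is split as `γ u₁ - (γ u₁ -
  -- u₂)`. The weight `α₁/γ²` makes the square of `γ u₁` come out as `α₁ u₁²`.
  have h3 := abs_two_mul_le_sqrt_div hμ (div_pos hα (pow_pos hγ 2)) w2 (p.γ * u1)
  have e3 : p.μ / (p.α1 / p.γ ^ 2) = p.μ * p.γ ^ 2 / p.α1 := by field_simp
  have e3' : p.α1 / p.γ ^ 2 * (p.γ * u1) ^ 2 = p.α1 * u1 ^ 2 := by field_simp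
  rw [e3, e3'] at h3
  have hD1 : Real.sqrt (p.ρ / p.α1) + Real.sqrt (p.μ * p.γ ^ 2 / p.α1) ≤ p.densityBound :=
    le_max_left _ _
  have hD2 : Real.sqrt (p.μ / p.β) + Real.sqrt (p.μ * p.γ ^ 2 / p.α1) ≤ p.densityBound :=
    (le_max_left _ _).trans (le_max_right _ _)
  have s1 := Real.sqrt_nonneg (p.ρ / p.α1)
  have s2 := Real.sqrt_nonneg (p.μ / p.β)
  have s3 := Real.sqrt_nonneg (p.μ * p.γ ^ 2 / p.α1)
  have hsplit : |p.ρ * (w1 * u1) + p.μ * (w2 * u2)| ≤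
      p.ρ * |w1 * u1| + (p.μ * |w2 * (p.γ * u1 - u2)| + p.μ * |w2 * (p.γ * u1)|) := by
    have : p.ρ * (w1 * u1) + p.μ * (w2 * u2) = p.ρ * (w1 * u1) +
      (-(p.μ * (w2 * (p.γ * u1 - u2))) + p.μ * (w2 * (p.γ * u1))) := by ring
    rw [this]
    refine (abs_add_le _ _).trans (add_le_add ?_ ((abs_add_le _ _).trans (add_le_add ?_ ?_)))
    · rw [abs_mul, abs_of_pos hρ]
    · rw [abs_neg, abs_mul, abs_of_pos hμ]
    · rw [abs_mul, abs_of_pos hμ]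
  have k1 := mul_le_mul_of_nonneg_right (show √(p.ρ / p.α1) ≤ p.densityBound by linarith)
    (show 0 ≤ p.ρ * w1 ^ 2 by positivity)
  have k2 := mul_le_mul_of_nonneg_right hD1 (show 0 ≤ p.α1 * u1 ^ 2 by positivity)
  have k3 := mul_le_mul_of_nonneg_right hD2 (show 0 ≤ p.μ * w2 ^ 2 by positivity)
  have k4 := mul_le_mul_of_nonneg_right (show √(p.μ / p.β) ≤ p.densityBound by linarith)
    (show 0 ≤ p.β * (p.γ * u1 - u2) ^ 2 by positivity)
  linarith

theorem Plant.densityBound_pos (p : Plant) : 0 < p.densityBound :=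
  lt_of_lt_of_le two_pos
    ((le_max_left _ _).trans ((le_max_right _ _).trans (le_max_right _ _)))

/-- The origin of `M`: multiplier weight `a₁`, times the bound `x ≤ l₂`, times the density constant.
-/
theorem Plant.M_eq (p : Plant) (b1 : ℝ) : p.M b1 = p.a1 b1 * p.l2 * p.densityBound := by
  simp only [Plant.M, Plant.Mtilde, Plant.a1, Plant.densityBound]
  ring

theorem abs_multiplier_le (X : State p n) :
    |multiplier X| ≤ p.l2 * p.densityBound * energy X := by
  have h := fun (m : C(ℝ, ℝ)) (f g : L2 0 p.l2) => L2.integrable_weight_mul m f g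
  have hD := p.densityBound_pos
  have hl := p.l2_pos
  have hm : multiplier X = ∫ x in Set.Ioc 0 p.l2,
      x * (p.ρ * (X.w1 x * X.u1 x) + p.μ * (X.w2 x * X.u2 x)) := by
    rw [multiplier, pair_apply, pair_apply, ← integral_const_mul, ← integral_const_mul,
      ← integral_add ((h _ _ _).const_mul _) ((h _ _ _).const_mul _)]
    refine integral_congr_ae (Filter.Eventually.of_forall fun x => ?_)
    simp only [ContinuousMap.id_apply]; ring
  have key : |multiplier X| ≤ ∫ x in (0 : ℝ)..p.l2, p.l2 * p.densityBound * (1 / 2 *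
      (p.ρ * (X.w1 x) ^ 2 + p.μ * (X.w2 x) ^ 2 + p.α1 * (X.u1 x) ^ 2
      + p.β * (p.γ * X.u1 x - X.u2 x) ^ 2)) := by
    rw [hm, intervalIntegral.integral_of_le hl.le, ← Real.norm_eq_abs]
    refine norm_integral_le_of_norm_le ?_ ?_
    · have i := fun f : L2 0 p.l2 => (Lp.memLp f).integrable_sq
      have iv := (((Lp.memLp X.u1).const_mul p.γ).sub (Lp.memLp X.u2)).integrable_sq
      exact ((((((i X.w1).const_mul p.ρ).add ((i X.w2).const_mul p.μ)).add
        ((i X.u1).const_mul p.α1)).add (iv.const_mul p.β)).const_mul _).const_mul _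
    · filter_upwards [ae_restrict_mem measurableSet_Ioc] with x hx
      rw [Real.norm_eq_abs, abs_mul, abs_of_pos hx.1, mul_assoc]
      exact mul_le_mul hx.2 (p.density_le _ _ _ _) (abs_nonneg _) hl.le
  refine key.trans ?_
  rw [intervalIntegral.integral_const_mul, intervalIntegral.integral_const_mul,
    ← beamForm_eq_integral, energy_eq]
  have hz := pair_one_self_nonneg X.z
  gcongr
  linarith

/-! ### Energy and multiplier identities -/

/-- The energy and multiplier identities of the closed-loop operator, in terms of the boundary
values at `x = l₂`. -/
theorem ClosedLoop.identities {C : HybridController n} {X Y : State p n} (h : ClosedLoop p C X Y)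
    (P : Matrix (Fin n) (Fin n) ℝ) :
    ∃ (D W1 W2 U1 U2 : ℝ), pair 1 X.z X.z ≤ p.l1 ^ 2 / 2 * D ∧
      p.α * U1 - p.γ * p.β * U2 = -C.ξ1 * W1 ∧
      -p.γ * p.β * U1 + p.β * U2 = -(C.c ⬝ᵥ X.q) - C.d * W2 ∧
      energyRate P X Y = -(p.κ * D) - C.ξ1 * W1 ^ 2 - W2 * (C.c ⬝ᵥ X.q + C.d * W2)
        + (C.A *ᵥ X.q + W2 • C.b) ⬝ᵥ (P *ᵥ X.q) ∧
      multiplierRate X Y = 1 / 2 * p.l2 * (p.ρ * W1 ^ 2 + p.μ * W2 ^ 2 + p.α * U1 ^ 2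
        - 2 * (p.γ * p.β) * U1 * U2 + p.β * U2 ^ 2) - 1 / 2 * beamForm X := by
  obtain ⟨z, zx, u1, u2, w1, w2, Dz, DDz, Du1, Du2, Dw1, Dw2, hz, hzx, hu1, hu2, hw1, hw2, bz, bw2,
    bzw, bκ, bξ, bc, Yz, Yu1, Yu2, Yw1, Yw2, Yq⟩ := h
  have hl1 : -p.l1 ≤ 0 := by linarith [p.l1_pos]
  have hl := p.l2_pos.le
  have Ez : pair 1 Y.z X.z = p.κ * pair 1 DDz X.z := by rw [Yz]; simp
  have Ew1 : ∀ m g, p.ρ * pair m Y.w1 g = p.α * pair m Du1 g - p.γ * p.β * pair m Du2 g := by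
    intro m g
    have := congrArg (fun f => pair m f g) Yw1
    simpa using this
  have Ew2 : ∀ m g, p.μ * pair m Y.w2 g = -(p.γ * p.β) * pair m Du1 g + p.β * pair m Du2 g := by
    intro m g
    have := congrArg (fun f => pair m f g) Yw2
    simpa using this
  -- `D` is `‖z_x‖²`; the other witnesses are the traces at `l₂`.
  refine ⟨pair 1 Dz Dz, w1 p.l2, w2 p.l2, u1 p.l2, u2 p.l2, ?_, bξ, bc, ?_, ?_⟩
  · simpa using hz.poincare hl1 bz
  · have i0 := hz.pair_one hl1 hzx
    have i1 := hu1.pair_one hl hw1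
    have i2 := hu2.pair_one hl hw1
    have i3 := hu1.pair_one hl hw2
    have i4 := hu2.pair_one hl hw2
    rw [pair_comm 1 X.z DDz] at i0
    rw [pair_comm 1 X.u1 Dw1] at i1
    rw [pair_comm 1 X.u2 Dw1] at i2
    rw [bz, zero_mul, sub_zero, bzw] at i0
    rw [bw2, mul_zero] at i3 i4
    rw [pair_comm 1 X.u2 Dw2] at i4
    rw [energyRate, Ez, Ew1, Ew2, Yu1, Yu2, Yq]
    -- Continuity of velocity and of flux makes the rod and beam terms at the joint cancel; the
    -- terms at `l₂` are replaced by the feedback.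
    linear_combination p.κ * i0 + p.α * i1 - p.γ * p.β * i2 - p.γ * p.β * i3 + p.β * i4
      + w1 0 * bκ + w1 p.l2 * bξ + w2 p.l2 * bc
  · have i1 := hu1.pair_id hl hu1
    have i2 := hu1.pair_id hl hu2
    have i3 := hu2.pair_id hl hu2
    have i4 := hw1.pair_id hl hw1
    have i5 := hw2.pair_id hl hw2
    rw [pair_comm _ X.u1 Du1] at i1
    rw [pair_comm _ X.u1 Du2] at i2
    rw [pair_comm _ X.u2 Du2] at i3
    rw [pair_comm _ Dw1 X.w1] at i4
    rw [pair_comm _ Dw2 X.w2] at i5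
    rw [multiplierRate, beamForm, Yu1, Yu2, mul_add, mul_add, Ew1, Ew2]
    linear_combination 1 / 2 * (p.α * i1 - 2 * (p.γ * p.β) * i2 + p.β * i3 + p.ρ * i4 + p.μ * i5)

/-! ### The controller -/

/-- The contribution of the controller to the energy balance. -/
theorem HybridController.MKY.dissipation {C : HybridController n} {Γ : ℝ}
    {Q P : Matrix (Fin n) (Fin n) ℝ} {q1 : Fin n → ℝ} {Δ : ℝ} (h : C.MKY Γ Q P q1 Δ)
    (hΓ : Γ ≤ C.d) (q : Fin n → ℝ) (w : ℝ) :
    (C.A *ᵥ q + w • C.b) ⬝ᵥ (P *ᵥ q) - w * (C.c ⬝ᵥ q + C.d * w) ≤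
      -(Γ * w ^ 2) - 1 / 2 * Δ * (q ⬝ᵥ (Q *ᵥ q)) := by
  obtain ⟨-, hP, -, hL, hb⟩ := h
  have hPt : Pᵀ = P := by simpa using hP.isHermitian.eq
  have hswap : ∀ x y : Fin n → ℝ, x ⬝ᵥ (P *ᵥ y) = (P *ᵥ x) ⬝ᵥ y := fun x y => by
    rw [dotProduct_mulVec, ← mulVec_transpose, hPt]
  have e1 : C.b ⬝ᵥ (P *ᵥ q) = C.c ⬝ᵥ q + √(2 * (C.d - Γ)) * (q1 ⬝ᵥ q) := by
    have hb' : P *ᵥ C.b = C.c + √(2 * (C.d - Γ)) • q1 := by rw [← hb]; abel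
    rw [hswap, hb', add_dotProduct, smul_dotProduct, smul_eq_mul]
  have e2 : 2 * ((C.A *ᵥ q) ⬝ᵥ (P *ᵥ q)) = -(q1 ⬝ᵥ q) ^ 2 - Δ * (q ⬝ᵥ (Q *ᵥ q)) := by
    have h1 : q ⬝ᵥ ((C.Aᵀ * P + P * C.A) *ᵥ q) = 2 * ((C.A *ᵥ q) ⬝ᵥ (P *ᵥ q)) := by
      have ha : q ⬝ᵥ (C.Aᵀ *ᵥ (P *ᵥ q)) = (C.A *ᵥ q) ⬝ᵥ (P *ᵥ q) := by
        rw [dotProduct_mulVec, vecMul_transpose]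
      have hb : q ⬝ᵥ (P *ᵥ (C.A *ᵥ q)) = (C.A *ᵥ q) ⬝ᵥ (P *ᵥ q) := by
        rw [hswap, dotProduct_comm]
      rw [add_mulVec, dotProduct_add, ← mulVec_mulVec, ← mulVec_mulVec, ha, hb]
      ring
    rw [← h1, hL, sub_mulVec, neg_mulVec, smul_mulVec, vecMulVec_mulVec, dotProduct_sub,
      dotProduct_neg]
    simp [dotProduct_comm q q1, sq]
  have hs : √(2 * (C.d - Γ)) ^ 2 = 2 * (C.d - Γ) := Real.sq_sqrt (by linarith)
  have hsq : (√(2 * (C.d - Γ)) * w) ^ 2 = 2 * (C.d - Γ) * w ^ 2 := by rw [mul_pow, hs]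
  rw [add_dotProduct, smul_dotProduct, smul_eq_mul, e1]
  -- The two sides differ by half of this square; its `w²` term `(d - Γ) w²` turns `-d w²` into `-Γ
  -- w²`.
  nlinarith [sq_nonneg (q1 ⬝ᵥ q - √(2 * (C.d - Γ)) * w)]

theorem sq_dotProduct_le (x y : Fin n → ℝ) : (x ⬝ᵥ y) ^ 2 ≤ (x ⬝ᵥ x) * (y ⬝ᵥ y) := by
  simpa only [dotProduct, sq] using Finset.sum_mul_sq_le_sq_mul_sq Finset.univ x y

/-! ### Consequences of the smallness of `δ` -/

theorem Plant.speed_pos (p : Plant) : 0 < p.speed :=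
  lt_of_lt_of_le (mul_pos two_pos (Real.sqrt_pos.2 (div_pos p.β_pos p.μ_pos))) (le_max_right _ _)

theorem Plant.a1_pos (p : Plant) {b1 : ℝ} (hb1 : 0 < b1) : 0 < p.a1 b1 := by
  have := p.speed_pos; have := p.l1_pos; have := p.l2_pos; have := p.κ_pos
  unfold Plant.a1; positivity

theorem Plant.M_pos (p : Plant) {b1 : ℝ} (hb1 : 0 < b1) : 0 < p.M b1 := by
  rw [p.M_eq]
  exact mul_pos (mul_pos (p.a1_pos hb1) p.l2_pos) p.densityBound_pos

/-- The reciprocal roots `√(α₁/ρ)` and `√(ρ/α₁)` bound the two factors from below. This yields `2 b₁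
l₂ δ ≤ M δ < 1`, which is what heat dissipation needs. -/
theorem Plant.one_le_speed_mul_densityBound (p : Plant) : 1 ≤ p.speed * p.densityBound := by
  have hρ := p.ρ_pos; have hα := p.α1_pos
  have h1 : √(p.α1 / p.ρ) ≤ p.speed :=
    le_trans (le_add_of_nonneg_right (by positivity)) (le_max_left _ _)
  have h2 : √(p.ρ / p.α1) ≤ p.densityBound :=
    le_trans (le_add_of_nonneg_right (by positivity)) (le_max_left _ _)
  have h3 : √(p.α1 / p.ρ) * √(p.ρ / p.α1) = 1 := by
    rw [← Real.sqrt_mul (by positivity), div_mul_div_cancel₀ hρ.ne', div_self hα.ne',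
      Real.sqrt_one]
  rw [← h3]
  exact mul_le_mul h1 h2 (Real.sqrt_nonneg _) p.speed_pos.le

theorem Plant.two_mul_b1_mul_l2_le_M (p : Plant) {b1 : ℝ} (hb1 : 0 < b1) :
    2 * b1 * p.l2 ≤ p.M b1 := by
  have h := p.one_le_speed_mul_densityBound
  have hD := p.densityBound_pos
  have := p.l1_pos; have hl := p.l2_pos; have := p.κ_pos
  have h1 : p.M b1 = 2 * b1 * p.l2 *
      (4 * p.l2 * p.κ / p.l1 ^ 2 * p.densityBound + p.speed * p.densityBound) := by
    rw [p.M_eq, Plant.a1]; ring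
  rw [h1]
  refine le_mul_of_one_le_right (by positivity) (h.trans (le_add_of_nonneg_left (by positivity)))

namespace DeltaAdmissible

variable {C : HybridController n} {Γ Δ b1 δ : ℝ} {Q P : Matrix (Fin n) (Fin n) ℝ}

theorem mul_M_lt_one (h : DeltaAdmissible p C Γ Q P Δ b1 δ) (hb1 : 0 < b1) :
    p.M b1 * δ < 1 := by
  have ha := mul_pos (p.a1_pos hb1) p.l2_pos
  have hM := p.M_pos hb1
  have h1 : δ < 1 / (p.a1 b1 * p.l2) * (p.a1 b1 * p.l2 / p.M b1) :=
    h.2.1.trans_le (mul_le_mul_of_nonneg_left (min_le_left _ _) (by positivity))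
  rw [one_div, inv_mul_eq_div, div_div_cancel_left' ha.ne', ← one_div, lt_div_iff₀ hM] at h1
  linarith

theorem boundary_w1 (h : DeltaAdmissible p C Γ Q P Δ b1 δ) (hb1 : 0 < b1) :
    δ * p.a1 b1 * p.l2 * (p.ρ + C.ξ1 ^ 2 * (2 / p.α1)) ≤ 2 * C.ξ1 := by
  have ha := mul_pos (p.a1_pos hb1) p.l2_pos
  have := p.ρ_pos; have := p.α1_pos
  have hd : 0 < p.ρ + C.ξ1 ^ 2 * (2 / p.α1) := by positivity
  have h1 : δ < 1 / (p.a1 b1 * p.l2) * (2 * C.ξ1 / (p.ρ + C.ξ1 ^ 2 * (2 / p.α1))) :=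
    h.2.1.trans_le (mul_le_mul_of_nonneg_left ((min_le_right _ _).trans (min_le_left _ _))
      (by positivity))
  rw [one_div, inv_mul_eq_div, div_div, lt_div_iff₀ (mul_pos hd ha)] at h1
  linarith

theorem boundary_w2 (h : DeltaAdmissible p C Γ Q P Δ b1 δ) (hb1 : 0 < b1) :
    δ * p.a1 b1 * p.l2 * (p.μ + 2 * C.d ^ 2 * ((p.α + p.γ ^ 2 * p.β) / (p.α1 * p.β)))
      ≤ 2 * Γ := by
  have ha := mul_pos (p.a1_pos hb1) p.l2_pos
  have := p.μ_pos; have := p.α1_pos; have := p.β_pos; have := p.γ_pos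
  have : 0 < p.α := by unfold Plant.α; positivity
  have hd : 0 < p.μ + 2 * C.d ^ 2 * ((p.α + p.γ ^ 2 * p.β) / (p.α1 * p.β)) := by positivity
  have h1 : δ < 1 / (p.a1 b1 * p.l2) *
      (2 * Γ / (p.μ + 2 * C.d ^ 2 * ((p.α + p.γ ^ 2 * p.β) / (p.α1 * p.β)))) :=
    h.2.1.trans_le (mul_le_mul_of_nonneg_left ((min_le_right _ _).trans (min_le_right _ _))
      (by positivity))
  rw [one_div, inv_mul_eq_div, div_div, lt_div_iff₀ (mul_pos hd ha)] at h1
  linarith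

theorem controller (h : DeltaAdmissible p C Γ Q P Δ b1 δ) (hb1 : 0 < b1) (hP : P.PosDef)
    (q : Fin n → ℝ) :
    δ * p.a1 b1 * p.l2 * ((2 * p.α + 2 * p.γ ^ 2 * p.β) / (p.α1 * p.β) * (C.c ⬝ᵥ C.c) * (q ⬝ᵥ q))
      + δ * (8 * b1 * p.l2 * p.κ / p.l1 ^ 2) * (q ⬝ᵥ (P *ᵥ q)) ≤ Δ * (q ⬝ᵥ (Q *ᵥ q)) := by
  -- The bound on `δ` is assumed only for nonzero vectors; at `0` both sides vanish.
  rcases eq_or_ne q 0 with rfl | hq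
  · simp
  have ha1 := p.a1_pos hb1
  have ha := mul_pos ha1 p.l2_pos
  have := p.α1_pos; have := p.β_pos; have := p.γ_pos; have hl1 := p.l1_pos; have := p.κ_pos
  have : 0 < p.α := by unfold Plant.α; positivity
  have hPq : 0 < q ⬝ᵥ (P *ᵥ q) := by simpa using hP.dotProduct_mulVec_pos hq
  have hc : 0 ≤ C.c ⬝ᵥ C.c := by simpa using dotProduct_star_self_nonneg C.c
  have hqq : 0 ≤ q ⬝ᵥ q := by simpa using dotProduct_star_self_nonneg q
  have hd : 0 < (2 * p.α + 2 * p.γ ^ 2 * p.β) / (p.α1 * p.β) * (C.c ⬝ᵥ C.c) * (q ⬝ᵥ q)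
      + 8 * b1 * p.κ / (p.a1 b1 * p.l1 ^ 2) * (q ⬝ᵥ (P *ᵥ q)) := by positivity
  have h1 := h.2.2 q hq
  rw [one_div, inv_mul_eq_div, div_div, lt_div_iff₀ (mul_pos hd ha)] at h1
  refine le_trans (le_of_eq ?_) h1.le
  field_simp

end DeltaAdmissible

/-! ### Dissipation inequality -/

/-- Solving for the strains gives `α₁ U₁ = σ₁ + γ σ₂` and `β (U₂ - γ U₁) = σ₂`, so the form equals
`(σ₁ + γ σ₂)²/α₁ + σ₂²/β`. The estimate `(x + y)² ≤ 2x² + 2y²` produces the constants in the bound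
on `δ`. -/
theorem elastic_le {α1 β γ U1 U2 σ1 σ2 : ℝ} (hα : 0 < α1) (hβ : 0 < β)
    (h1 : (α1 + γ ^ 2 * β) * U1 - γ * β * U2 = σ1) (h2 : -γ * β * U1 + β * U2 = σ2) :
    (α1 + γ ^ 2 * β) * U1 ^ 2 - 2 * (γ * β) * U1 * U2 + β * U2 ^ 2 ≤
      2 / α1 * σ1 ^ 2 + (α1 + γ ^ 2 * β + γ ^ 2 * β) / (α1 * β) * σ2 ^ 2 := by
  have e1 : U1 = (σ1 + γ * σ2) / α1 := by
    rw [eq_div_iff hα.ne']; linear_combination h1 + γ * h2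
  have e2 : U2 - γ * U1 = σ2 / β := by
    rw [eq_div_iff hβ.ne']; linear_combination h2
  have e : (α1 + γ ^ 2 * β) * U1 ^ 2 - 2 * (γ * β) * U1 * U2 + β * U2 ^ 2 =
      (σ1 + γ * σ2) ^ 2 / α1 + σ2 ^ 2 / β := by
    have : (α1 + γ ^ 2 * β) * U1 ^ 2 - 2 * (γ * β) * U1 * U2 + β * U2 ^ 2 =
      α1 * U1 ^ 2 + β * (U2 - γ * U1) ^ 2 := by ring
    rw [this, e2, e1]
    field_simp
  have e' : 2 / α1 * σ1 ^ 2 + (α1 + γ ^ 2 * β + γ ^ 2 * β) / (α1 * β) * σ2 ^ 2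
      = (2 * σ1 ^ 2 + 2 * (γ * σ2) ^ 2) / α1 + σ2 ^ 2 / β := by
    field_simp; ring
  rw [e, e']
  gcongr
  nlinarith [sq_nonneg (σ1 - γ * σ2)]

/-- The Lyapunov functional decreases along the closed-loop dynamics at least at the rate
`δ (8 b₁ l₂ κ / l₁²) E`. -/
theorem ClosedLoop.dissipation {C : HybridController n} {Γ Δ b1 δ : ℝ}
    {Q P : Matrix (Fin n) (Fin n) ℝ} {q1 : Fin n → ℝ} (hΓ : Γ ≤ C.d) (hMKY : C.MKY Γ Q P q1 Δ)
    (hb1 : 0 < b1) (hδ : DeltaAdmissible p C Γ Q P Δ b1 δ) {X Y : State p n}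
    (h : ClosedLoop p C X Y) :
    energyRate P X Y + δ * p.a1 b1 * multiplierRate X Y ≤
      -(δ * (8 * b1 * p.l2 * p.κ / p.l1 ^ 2)) * energyHybrid P X := by
  obtain ⟨D, W1, W2, U1, U2, hz, h1, h2, hE, hF⟩ := h.identities P
  have hl1 := p.l1_pos; have hl2 := p.l2_pos; have hκ := p.κ_pos; have hα := p.α1_pos
  have hβ := p.β_pos; have hγ := p.γ_pos
  have hδ0 := hδ.1
  have ha1 := p.a1_pos hb1
  have hel := elastic_le hα hβ h1 h2
  rw [← Plant.α] at hel
  have hctr := hMKY.dissipation hΓ X.q W2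
  have k1 := mul_le_mul_of_nonneg_right (hδ.boundary_w1 hb1) (sq_nonneg W1)
  have k2 := mul_le_mul_of_nonneg_right (hδ.boundary_w2 hb1) (sq_nonneg W2)
  have k3 := hδ.controller hb1 hMKY.2.1 X.q
  have hcs := sq_dotProduct_le C.c X.q
  set r := δ * (8 * b1 * p.l2 * p.κ / p.l1 ^ 2) with hr
  set e := δ * p.a1 b1 with he
  have he0 : 0 < e := mul_pos hδ0 ha1
  set θ := (p.α + p.γ ^ 2 * p.β) / (p.α1 * p.β) with hθ
  have hθ0 : 0 ≤ θ := by
    have : 0 < p.α := by unfold Plant.α; positivity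
    positivity
  have hθ2 : (2 * p.α + 2 * p.γ ^ 2 * p.β) / (p.α1 * p.β) = 2 * θ := by rw [hθ]; ring
  rw [hθ2] at k3
  -- `8 b₁ l₂ κ / l₁²` is one of the two summands of `a₁`.
  have hre : r ≤ e := by
    have : 0 ≤ δ * (2 * b1 * p.speed) := by have := p.speed_pos; positivity
    have : e = r + δ * (2 * b1 * p.speed) := by rw [he, hr, Plant.a1]; ring
    linarith
  have hbeam : r * beamForm X ≤ e * beamForm X :=
    mul_le_mul_of_nonneg_right hre (beamForm_nonneg X)
  have hrz : r / 2 * pair 1 X.z X.z ≤ p.κ * D := by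
    have hsmall : 2 * b1 * p.l2 * δ ≤ 1 :=
      (mul_le_mul_of_nonneg_right (p.two_mul_b1_mul_l2_le_M hb1) hδ0.le).trans
        (hδ.mul_M_lt_one hb1).le
    have hr' : r / 2 * (p.l1 ^ 2 / 2) = 2 * b1 * p.l2 * δ * p.κ := by
      rw [hr]; field_simp; ring
    have hr0 : 0 ≤ r := by positivity
    have hD : 0 ≤ D := by
      have := (pair_one_self_nonneg X.z).trans hz
      exact nonneg_of_mul_nonneg_right this (by positivity)
    calc r / 2 * pair 1 X.z X.z ≤ r / 2 * (p.l1 ^ 2 / 2 * D) := by gcongr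
      _ = 2 * b1 * p.l2 * δ * (p.κ * D) := by rw [← mul_assoc, hr']; ring
      _ ≤ 1 * (p.κ * D) := by gcongr
      _ = p.κ * D := one_mul _
  -- Separates controller state from velocity; the factors 2 here are those of `2d²` and `2‖c‖²` in
  -- the bound on `δ`.
  have hσ2 : (-(C.c ⬝ᵥ X.q) - C.d * W2) ^ 2 ≤
      2 * ((C.c ⬝ᵥ C.c) * (X.q ⬝ᵥ X.q)) + 2 * C.d ^ 2 * W2 ^ 2 := by
    nlinarith [sq_nonneg (C.c ⬝ᵥ X.q - C.d * W2)]
  have hel2 := hel.trans (add_le_add_right (mul_le_mul_of_nonneg_left hσ2 hθ0) _)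
  have hel3 := mul_le_mul_of_nonneg_left hel2 (mul_pos he0 hl2).le
  rw [hE, hF, energyHybrid_eq]
  linarith

/-! ### Classical solutions -/

theorem abs_lyapunov_sub_le {P : Matrix (Fin n) (Fin n) ℝ} (hP : P.PosDef) {b1 δ : ℝ}
    (hb1 : 0 < b1) (hδ : 0 ≤ δ) (X : State p n) :
    |δ * p.a1 b1 * multiplier X| ≤ p.M b1 * δ * energyHybrid P X := by
  have h := abs_multiplier_le X
  have ha := p.a1_pos hb1
  have hM := p.M_pos hb1
  have hq : 0 ≤ X.q ⬝ᵥ (P *ᵥ X.q) := by simpa using hP.posSemidef.dotProduct_mulVec_nonneg X.q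
  calc |δ * p.a1 b1 * multiplier X| = δ * p.a1 b1 * |multiplier X| := by
        rw [abs_mul, abs_of_nonneg (by positivity)]
    _ ≤ δ * p.a1 b1 * (p.l2 * p.densityBound * energy X) := by gcongr
    _ = p.M b1 * δ * energy X := by rw [p.M_eq]; ring
    _ ≤ p.M b1 * δ * energyHybrid P X := by
        rw [energyHybrid]
        gcongr
        linarith

/-- Exponential decay for functions with `V' ≤ -σ V`. -/
theorem le_exp_mul_of_deriv_le {V V' : ℝ → ℝ} {σ : ℝ} (hV : ∀ t, HasDerivAt V (V' t) t)
    (hle : ∀ t, 0 ≤ t → V' t ≤ -σ * V t) {t : ℝ} (ht : 0 ≤ t) :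
    V t ≤ Real.exp (-σ * t) * V 0 := by
  have hd : ∀ s, HasDerivAt (fun s => Real.exp (σ * s) * V s)
      (Real.exp (σ * s) * (σ * V s + V' s)) s := fun s => by
    have h1 : HasDerivAt (fun s => Real.exp (σ * s)) (Real.exp (σ * s) * (σ * 1)) s :=
      ((hasDerivAt_id s).const_mul σ).exp
    exact (h1.mul (hV s)).congr_deriv (by ring)
  have hanti : AntitoneOn (fun s => Real.exp (σ * s) * V s) (Set.Ici 0) := by
    refine antitoneOn_of_deriv_nonpos (convex_Ici 0)
      (fun s _ => (hd s).continuousAt.continuousWithinAt)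
      (fun s _ => (hd s).differentiableAt.differentiableWithinAt) fun s hs => ?_
    rw [interior_Ici] at hs
    rw [(hd s).deriv]
    exact mul_nonpos_of_nonneg_of_nonpos (Real.exp_pos _).le (by linarith [hle s (le_of_lt hs)])
  have h := hanti Set.self_mem_Ici ht ht
  simp only [mul_zero, Real.exp_zero, one_mul] at h
  calc V t = Real.exp (-σ * t) * (Real.exp (σ * t) * V t) := by
        rw [← mul_assoc, ← Real.exp_add]; simp
    _ ≤ Real.exp (-σ * t) * V 0 := by gcongr

theorem energyHybrid_le_of_classical {C : HybridController n} {Γ Δ b1 δ : ℝ}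
    {Q P : Matrix (Fin n) (Fin n) ℝ} {q1 : Fin n → ℝ} (hΓ : Γ ≤ C.d) (hMKY : C.MKY Γ Q P q1 Δ)
    (hb1 : 0 < b1) (hδ : DeltaAdmissible p C Γ Q P Δ b1 δ) {Z Z' : ℝ → State p n}
    (hZ : ∀ t, HasDerivAt Z (Z' t) t) (hcl : ∀ t, 0 ≤ t → ClosedLoop p C (Z t) (Z' t))
    {t : ℝ} (ht : 0 ≤ t) :
    energyHybrid P (Z t) ≤ (1 + p.M b1 * δ) / (1 - p.M b1 * δ) *
      Real.exp (-(p.decayRate b1 δ) * t) * energyHybrid P (Z 0) := by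
  have hP := hMKY.2.1
  have hδ0 := hδ.1
  have hM0 : 0 < p.M b1 * δ := mul_pos (p.M_pos hb1) hδ0
  have hM1 := hδ.mul_M_lt_one hb1
  have hbd := fun X : State p n => abs_le.1 (abs_lyapunov_sub_le hP hb1 hδ0.le X)
  set r := δ * (8 * b1 * p.l2 * p.κ / p.l1 ^ 2) with hr
  have hr0 : 0 ≤ r := by
    have := p.l1_pos; have := p.l2_pos; have := p.κ_pos
    positivity
  have hσ : p.decayRate b1 δ = (1 - p.M b1 * δ) * r := by rw [Plant.decayRate, hr]; ring
  -- A bound `|·| ≤ M δ E` with `M δ > 0` forces `E ≥ 0`.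
  have hE0 : ∀ X : State p n, 0 ≤ energyHybrid P X := fun X => by
    have := hbd X
    nlinarith
  have hV : ∀ s, HasDerivAt (fun s => energyHybrid P (Z s) + δ * p.a1 b1 * multiplier (Z s))
      (energyRate P (Z s) (Z' s) + δ * p.a1 b1 * multiplierRate (Z s) (Z' s)) s := fun s =>
    (hasDerivAt_energyHybrid (by simpa using hP.isHermitian.eq) (hZ s)).add
      ((hasDerivAt_multiplier (hZ s)).const_mul _)
  have hle : ∀ s, 0 ≤ s →
      energyRate P (Z s) (Z' s) + δ * p.a1 b1 * multiplierRate (Z s) (Z' s) ≤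
        -p.decayRate b1 δ * (energyHybrid P (Z s) + δ * p.a1 b1 * multiplier (Z s)) := by
    intro s hs
    refine ((hcl s hs).dissipation hΓ hMKY hb1 hδ).trans ?_
    rw [hσ, neg_mul, neg_mul, neg_le_neg_iff, mul_comm (1 - p.M b1 * δ), mul_assoc]
    refine mul_le_mul_of_nonneg_left ?_ hr0
    -- `(1 - Mδ) V ≤ (1 - Mδ)(1 + Mδ) E ≤ E`.
    have h1 := mul_le_mul_of_nonneg_left (hbd (Z s)).2 (sub_nonneg.2 hM1.le)
    have h2 := mul_nonneg (sq_nonneg (p.M b1 * δ)) (hE0 (Z s))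
    nlinarith
  have hdec := le_exp_mul_of_deriv_le hV hle ht
  have hlow : (1 - p.M b1 * δ) * energyHybrid P (Z t) ≤
      Real.exp (-p.decayRate b1 δ * t) * ((1 + p.M b1 * δ) * energyHybrid P (Z 0)) := by
    refine le_trans ?_ (hdec.trans (mul_le_mul_of_nonneg_left ?_ (Real.exp_pos _).le))
    · linarith [(hbd (Z t)).1]
    · linarith [(hbd (Z 0)).2]
  rw [div_mul_eq_mul_div, div_mul_eq_mul_div, le_div_iff₀ (sub_pos.2 hM1)]
  linarith

/-! ### Mild solutions -/

/-- Linearity of the closed-loop relation, in the one combination that time averages require. -/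
theorem ClosedLoop.smul_sub {C : HybridController n} {X₁ Y₁ X₂ Y₂ : State p n}
    (h₁ : ClosedLoop p C X₁ Y₁) (h₂ : ClosedLoop p C X₂ Y₂) (c : ℝ) :
    ClosedLoop p C (c • (X₁ - X₂)) (c • (Y₁ - Y₂)) := by
  obtain ⟨z, zx, u1, u2, w1, w2, Dz, DDz, Du1, Du2, Dw1, Dw2, hz, hzx, hu1, hu2, hw1, hw2, bz, bw2,
    bzw, bκ, bξ, bc, Yz, Yu1, Yu2, Yw1, Yw2, Yq⟩ := h₁
  obtain ⟨z', zx', u1', u2', w1', w2', Dz', DDz', Du1', Du2', Dw1', Dw2', hz', hzx', hu1', hu2',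
    hw1', hw2', bz', bw2', bzw', bκ', bξ', bc', Yz', Yu1', Yu2', Yw1', Yw2', Yq'⟩ := h₂
  have hl1 : -p.l1 ≤ 0 := by linarith [p.l1_pos]
  have hl := p.l2_pos.le
  have eq : State.q (c • (X₁ - X₂)) = c • (X₁.q - X₂.q) := rfl
  have eYz : State.z (c • (Y₁ - Y₂)) = c • (Y₁.z - Y₂.z) := rfl
  have eYu1 : State.u1 (c • (Y₁ - Y₂)) = c • (Y₁.u1 - Y₂.u1) := rfl
  have eYu2 : State.u2 (c • (Y₁ - Y₂)) = c • (Y₁.u2 - Y₂.u2) := rfl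
  have eYw1 : State.w1 (c • (Y₁ - Y₂)) = c • (Y₁.w1 - Y₂.w1) := rfl
  have eYw2 : State.w2 (c • (Y₁ - Y₂)) = c • (Y₁.w2 - Y₂.w2) := rfl
  have eYq : State.q (c • (Y₁ - Y₂)) = c • (Y₁.q - Y₂.q) := rfl
  refine ⟨_, _, _, _, _, _, _, _, _, _, _, _, hz.smul_sub hl1 hz' c, hzx.smul_sub hl1 hzx' c,
    hu1.smul_sub hl hu1' c, hu2.smul_sub hl hu2' c, hw1.smul_sub hl hw1' c, hw2.smul_sub hl hw2' c,
    ?_, ?_, ?_, ?_, ?_, ?_, ?_, ?_, ?_, ?_, ?_, ?_⟩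
  · simp [bz, bz']
  · simp [bw2, bw2']
  · simp [bzw, bzw']
  · linear_combination c * bκ - c * bκ'
  · linear_combination c * bξ - c * bξ'
  · rw [eq, dotProduct_smul, dotProduct_sub, smul_eq_mul]
    linear_combination c * bc - c * bc'
  · rw [eYz, Yz, Yz']; module
  · rw [eYu1, Yu1, Yu1']
  · rw [eYu2, Yu2, Yu2']
  · rw [eYw1, smul_comm, _root_.smul_sub, Yw1, Yw1']; module
  · rw [eYw2, smul_comm, _root_.smul_sub, Yw2, Yw2']; module
  · rw [eYq, eq, Yq, Yq', mulVec_smul, mulVec_sub]; module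

/-- Steklov averages of a mild solution are classical solutions. -/
theorem IsSolution.closedLoop_average {C : HybridController n} {X : ℝ → State p n}
    (hX : IsSolution p C X) {h t : ℝ} (hh : 0 ≤ h) (ht : 0 ≤ t) :
    ClosedLoop p C (h⁻¹ • ((∫ s in (0 : ℝ)..(t + h), X s) - ∫ s in (0 : ℝ)..t, X s))
      (h⁻¹ • (X (t + h) - X t)) := by
  simpa using (hX.2 (t + h) (by positivity)).smul_sub (hX.2 t ht) h⁻¹

theorem IsSolution.energyHybrid_le {C : HybridController n} {Γ Δ b1 δ : ℝ}
    {Q P : Matrix (Fin n) (Fin n) ℝ} {q1 : Fin n → ℝ} (hΓ : Γ ≤ C.d) (hMKY : C.MKY Γ Q P q1 Δ)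
    (hb1 : 0 < b1) (hδ : DeltaAdmissible p C Γ Q P Δ b1 δ) {X : ℝ → State p n}
    (hX : IsSolution p C X) {t : ℝ} (ht : 0 ≤ t) :
    energyHybrid P (X t) ≤ (1 + p.M b1 * δ) / (1 - p.M b1 * δ) *
      Real.exp (-(p.decayRate b1 δ) * t) * energyHybrid P (X 0) := by
  -- Constant extension to negative times, so that the primitive `Y` has a two-sided derivative
  -- everywhere, including at `0`.
  set X' : ℝ → State p n := fun s => X (max 0 s) with hX'
  have hcont : Continuous X' := hX.1.comp_continuous (by fun_prop) fun s => Set.mem_Ici.2 (le_max_left _ _)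
  have hX'e : ∀ s, 0 ≤ s → X' s = X s := fun s hs => by simp [hX', max_eq_right hs]
  set Y : ℝ → State p n := fun s => ∫ τ in (0 : ℝ)..s, X' τ with hYdef
  have hY : ∀ s, HasDerivAt Y (X' s) s := fun s => hcont.integral_hasStrictDerivAt 0 s |>.hasDerivAt
  have hYe : ∀ s, 0 ≤ s → Y s = ∫ τ in (0 : ℝ)..s, X τ := fun s hs =>
    intervalIntegral.integral_congr fun τ hτ => hX'e τ (by
      rw [Set.uIcc_of_le hs] at hτ; exact hτ.1)
  have havg : ∀ h : ℝ, 0 < h → energyHybrid P (h⁻¹ • (Y (t + h) - Y t)) ≤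
      (1 + p.M b1 * δ) / (1 - p.M b1 * δ) * Real.exp (-(p.decayRate b1 δ) * t) *
        energyHybrid P (h⁻¹ • (Y (0 + h) - Y 0)) := by
    intro h hh
    refine energyHybrid_le_of_classical (Z := fun s => h⁻¹ • (Y (s + h) - Y s))
      (Z' := fun s => h⁻¹ • (X' (s + h) - X' s)) hΓ hMKY hb1 hδ ?_ ?_ ht
    · intro s
      exact (((hY (s + h)).comp_add_const s h).sub (hY s)).const_smul h⁻¹
    · intro s hs
      have hsh : 0 ≤ s + h := by positivity
      simp only [hX'e s hs, hX'e _ hsh, hYe s hs, hYe _ hsh]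
      exact hX.closedLoop_average hh.le hs
  have hlim : ∀ s, 0 ≤ s → Filter.Tendsto (fun h => energyHybrid P (h⁻¹ • (Y (s + h) - Y s)))
      (nhdsWithin 0 (Set.Ioi 0)) (nhds (energyHybrid P (X s))) := fun s hs => by
    rw [← hX'e s hs]
    -- The averages are right difference quotients of `Y`, whose derivative at `s` is `X' s`.
    exact ((continuous_energyHybrid P).tendsto _).comp (hY s).tendsto_slope_zero_right
  exact le_of_tendsto_of_tendsto (hlim t ht) ((hlim 0 le_rfl).const_mul _)
    (Filter.eventually_of_mem self_mem_nhdsWithin fun h hh => havg h hh)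

end PiezoHeat

theorem theorem3 (p : PiezoHeat.Plant) (n : ℕ) (C : PiezoHeat.HybridController n) (Γ : ℝ)
    (hA : PiezoHeat.IsHurwitz C.A)
    (hAb : PiezoHeat.IsControllable C.A C.b)
    (hAc : PiezoHeat.IsObservable C.A C.c)
    (hPR : C.PositiveReal Γ)
    (Q P : Matrix (Fin n) (Fin n) ℝ) (q1 : Fin n → ℝ) (Δ : ℝ)
    (hMKY : C.MKY Γ Q P q1 Δ)
    (b1 : ℝ) (hb1 : 0 < b1) (δ : ℝ)
    (hδ : PiezoHeat.DeltaAdmissible p C Γ Q P Δ b1 δ)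
    (X : ℝ → PiezoHeat.State p n) (hX : PiezoHeat.IsSolution p C X) :
    ∀ t : ℝ, 0 < t →
      PiezoHeat.energyHybrid P (X t) ≤
        (1 + p.M b1 * δ) / (1 - p.M b1 * δ) * Real.exp (-(p.decayRate b1 δ) * t)
          * PiezoHeat.energyHybrid P (X 0) := by
  exact fun t ht => hX.energyHybrid_le hPR.2.1 hMKY hb1 hδ ht.le
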